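/- Let $k\ge 1$ be an integer and write $[n]=\{1,\dots,n\}$. For an integer $n\ge 1$, let $L_n^k$ be the set of $k$-dimensional permutations of order $n$, i.e. of arrays $A:[n]^{k+1}\to\{0,1\}$ such that every line (the set of $n$ positions obtained by fixing $k$ of the coordinates and varying the remaining one) contains exactly one $1$. A monotone subsequence of length $m$ of $A\in L_n^k$ is a sequence $\alpha^1,\dots,\alpha^m\in[n]^{k+1}$ with $A(\alpha^i)=1$ for all $i$ such that, for every $1\le j\le k+1$, the sequence of $j$-th coordinates $\alpha^1_j,\dots,\alpha^m_j$ is strictly monotone (strictly increasing or strictly decreasing, where the direction may depend on $j$). Let $H_n^k$ be the length of the longest monotone subsequence of a uniformly random $A\in L_n^k$. Then, as $n\to\infty$ with $k$ fixed: 1. For every $\varepsilon>0$, $$\Pr\left[H_n^k\, n^{-\frac{k}{k+1}}\in\left[\tfrac{1}{k+2},\,e+\varepsilon\right]\right]\longrightarrow 1 .$$ 2. $$1-\frac{\ln k+1}{k+1}-o(1)\;\le\; E\left[H_n^k\, n^{-\frac{k}{k+1}}\right]\;\le\; e+o(1).$$ -/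

import Mathlib

open Filter Topology MeasureTheory ProbabilityTheory

/-- An `[n]^(k+1)` array with entries in `{0,1}` is a `k`-dimensional permutation of order `n` if
every line contains precisely one `1`.  The line through `x` in direction `j` consists of the
positions `Function.update x j t`, `t ∈ [n]`. -/
def IsHDPerm {n k : ℕ} (A : (Fin (k + 1) → Fin n) → Fin 2) : Prop :=
  ∀ (j : Fin (k + 1)) (x : Fin (k + 1) → Fin n), ∃! t : Fin n, A (Function.update x j t) = 1

/-- The set `L_n^k` of `k`-dimensional permutations of order `n`. -/
def HDPerm (n k : ℕ) : Type :=
  {A : (Fin (k + 1) → Fin n) → Fin 2 // IsHDPerm A}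

namespace HDPerm

variable {n k : ℕ}

instance : Finite (HDPerm n k) :=
  inferInstanceAs (Finite {A : (Fin (k + 1) → Fin n) → Fin 2 // IsHDPerm A})

/-- Every subset of the finite set `L_n^k` is an event. -/
instance : MeasurableSpace (HDPerm n k) := ⊤

/-- The support `G_A`. -/
def support (A : HDPerm n k) : Set (Fin (k + 1) → Fin n) :=
  {x | A.1 x = 1}

/-- `s` is a monotone subsequence of `A` of length `m`: its terms lie in the support of `A`, and
in each coordinate it is strictly increasing or strictly decreasing. -/
def IsMonotoneSubseq (A : HDPerm n k) {m : ℕ} (s : Fin m → Fin (k + 1) → Fin n) : Prop :=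
  (∀ i, s i ∈ A.support) ∧
    ∀ j, StrictMono (fun i => s i j) ∨ StrictAnti (fun i => s i j)

/-- The length of the longest monotone subsequence of `A`. -/
noncomputable def longestMonotone (A : HDPerm n k) : ℕ :=
  sSup {m : ℕ | ∃ s : Fin m → Fin (k + 1) → Fin n, A.IsMonotoneSubseq s}

/-- The set of lengths in `longestMonotone` is bounded, so that the supremum is a maximum. -/
theorem bddAbove_lengths (A : HDPerm n k) :
    BddAbove {m : ℕ | ∃ s : Fin m → Fin (k + 1) → Fin n, A.IsMonotoneSubseq s} := by
  refine ⟨n, ?_⟩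
  rintro m ⟨s, -, hs⟩
  have hinj : Function.Injective (fun i => s i 0) :=
    (hs 0).elim (fun h => h.injective) (fun h => h.injective)
  simpa using Fintype.card_le_of_injective _ hinj

/-- The uniform distribution on `L_n^k`. -/
noncomputable def unif (n k : ℕ) : Measure (HDPerm n k) :=
  uniformOn Set.univ

/-- The random variable `H_n^k * n ^ (-k/(k+1))`. -/
noncomputable def scaledLongest (A : HDPerm n k) : ℝ :=
  (A.longestMonotone : ℝ) * (n : ℝ) ^ (-((k : ℝ) / ((k : ℝ) + 1)))

end HDPerm

/-!
Relabelling the `n` values of each coordinate by independent uniform permutations preserves the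
uniform law on `L_n^k`, so it is enough to relabel one fixed array `A` at random.

For the upper tail, each of the `(n ^ k) ^ m` sequences of `m` points of the support becomes
monotone with probability at most `(2 / m!) ^ (k + 1)`, and a union bound applies.

For the lower tail, give the `(k + 1) n` pairs (coordinate, value) independent uniform labels in
`{1, …, N}` and sort the values of each coordinate by label. If the label `i` is hit, meaning that
some point of the support has all its coordinates labelled `i`, and likewise `j > i`, then the two
points become increasing, so `H` is at least the number of labels hit. The Chung–Erdős inequality
gives a lower bound for the probability that a label is hit. Distinct labels are hit in a negatively
correlated way, so Chebyshev's inequality concentrates the number of hits. With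
`N ~ b n ^ (k / (k + 1))` this gives `H n ^ (-k / (k + 1)) ≥ b / (b ^ (k + 1) + 1) - o(1)`; take
`b = 1` for the probability and `b ^ (k + 1) = 1 / k` for the expectation.
-/

section Probability

open scoped Finset

variable {Ω : Type*} {mΩ : MeasurableSpace Ω}

theorem sq_integral_mul_le {μ : Measure Ω} {X Y : Ω → ℝ} (hX : MemLp X 2 μ) (hY : MemLp Y 2 μ) :
    (∫ ω, X ω * Y ω ∂μ) ^ 2 ≤ (∫ ω, X ω ^ 2 ∂μ) * ∫ ω, Y ω ^ 2 ∂μ := by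
  have hquad : ∀ t : ℝ, 0 ≤ (∫ ω, Y ω ^ 2 ∂μ) * (t * t) + (-2 * ∫ ω, X ω * Y ω ∂μ) * t +
      ∫ ω, X ω ^ 2 ∂μ := fun t => by
    have hYY : Integrable (fun ω => t * t * Y ω ^ 2) μ := hY.integrable_sq.const_mul _
    have hXY : Integrable (fun ω => 2 * t * (X ω * Y ω)) μ := (hX.integrable_mul hY).const_mul _
    calc 0 ≤ ∫ ω, (X ω - t * Y ω) ^ 2 ∂μ := integral_nonneg fun ω => sq_nonneg _
      _ = ∫ ω, (t * t * Y ω ^ 2 - 2 * t * (X ω * Y ω) + X ω ^ 2) ∂μ := by congr with ω; ring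
      _ = _ := by
        rw [integral_add (f := fun ω => t * t * Y ω ^ 2 - 2 * t * (X ω * Y ω)) (hYY.sub hXY)
          hX.integrable_sq, integral_sub hYY hXY,
          integral_const_mul, integral_const_mul]
        ring
  have hdiscrim := discrim_le_zero hquad
  rw [discrim] at hdiscrim
  linarith

theorem memLp_indicator_one {μ : Measure Ω} [IsFiniteMeasure μ] {s : Set Ω} (hs : MeasurableSet s)
    (p : ENNReal) : MemLp (s.indicator (1 : Ω → ℝ)) p μ :=
  memLp_indicator_const p hs 1 (Or.inr (measure_ne_top μ s))

theorem integral_indicator_one_mul_indicator_one {μ : Measure Ω} {s t : Set Ω}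
    (hs : MeasurableSet s) (ht : MeasurableSet t) :
    ∫ ω, s.indicator (1 : Ω → ℝ) ω * t.indicator 1 ω ∂μ = μ.real (s ∩ t) := by
  rw [← integral_indicator_one (hs.inter ht), Set.inter_indicator_one]
  rfl

/-- The Chung–Erdős inequality. -/
theorem sq_sum_measureReal_le_measureReal_biUnion_mul {ι : Type*} {μ : Measure Ω}
    [IsFiniteMeasure μ] (I : Finset ι) {B : ι → Set Ω} (hB : ∀ i, MeasurableSet (B i)) :
    (∑ i ∈ I, μ.real (B i)) ^ 2 ≤
      (∑ i ∈ I, ∑ j ∈ I, μ.real (B i ∩ B j)) * μ.real (⋃ i ∈ I, B i) := by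
  set U : Set Ω := ⋃ i ∈ I, B i
  have hUm : MeasurableSet U := I.measurableSet_biUnion fun i _ => hB i
  have hprod : ∀ {s t : Set Ω}, MeasurableSet s → MeasurableSet t →
      Integrable (fun ω => s.indicator (1 : Ω → ℝ) ω * t.indicator 1 ω) μ := fun hs ht =>
    (memLp_indicator_one hs 2).integrable_mul (memLp_indicator_one ht 2)
  have hcount : ∫ ω, (∑ i ∈ I, (B i).indicator (1 : Ω → ℝ) ω) * U.indicator 1 ω ∂μ =
      ∑ i ∈ I, μ.real (B i) := by
    simp only [Finset.sum_mul]
    rw [integral_finsetSum _ fun i _ => hprod (hB i) hUm]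
    refine Finset.sum_congr rfl fun i hi => ?_
    have hBU : B i ⊆ U := Set.subset_iUnion₂_of_subset i hi subset_rfl
    rw [integral_indicator_one_mul_indicator_one (hB i) hUm, Set.inter_eq_left.2 hBU]
  have hcount_sq : ∫ ω, (∑ i ∈ I, (B i).indicator (1 : Ω → ℝ) ω) ^ 2 ∂μ =
      ∑ i ∈ I, ∑ j ∈ I, μ.real (B i ∩ B j) := by
    simp only [sq, Finset.sum_mul_sum]
    rw [integral_finsetSum _ fun i _ => integrable_finsetSum _ fun j _ => hprod (hB i) (hB j)]
    refine Finset.sum_congr rfl fun i _ => ?_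
    rw [integral_finsetSum _ fun j _ => hprod (hB i) (hB j)]
    exact Finset.sum_congr rfl fun j _ => integral_indicator_one_mul_indicator_one (hB i) (hB j)
  have hunion : ∫ ω, U.indicator (1 : Ω → ℝ) ω ^ 2 ∂μ = μ.real U := by
    simp only [sq]
    rw [integral_indicator_one_mul_indicator_one hUm hUm, Set.inter_self]
  rw [← hcount, ← hcount_sq, ← hunion]
  exact sq_integral_mul_le (memLp_finsetSum I fun i _ => memLp_indicator_one (hB i) 2)
    (memLp_indicator_one hUm 2)

theorem covariance_indicator_one {μ : Measure Ω} [IsProbabilityMeasure μ] {s t : Set Ω}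
    (hs : MeasurableSet s) (ht : MeasurableSet t) :
    cov[s.indicator 1, t.indicator 1; μ] = μ.real (s ∩ t) - μ.real s * μ.real t := by
  rw [covariance_eq_sub (memLp_indicator_one hs 2) (memLp_indicator_one ht 2),
    ← Set.inter_indicator_one, integral_indicator_one (hs.inter ht), integral_indicator_one hs,
    integral_indicator_one ht]

theorem variance_indicator_one_le {μ : Measure Ω} [IsProbabilityMeasure μ] {s : Set Ω}
    (hs : MeasurableSet s) : Var[s.indicator 1; μ] ≤ 1 / 4 := by
  rw [← covariance_self (memLp_indicator_one hs 2).aemeasurable, covariance_indicator_one hs hs,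
    Set.inter_self]
  linarith [sq_nonneg (μ.real s - 1 / 2)]

theorem variance_sum_indicator_one_le {ι : Type*} [Fintype ι] {μ : Measure Ω}
    [IsProbabilityMeasure μ] {B : ι → Set Ω} (hB : ∀ i, MeasurableSet (B i))
    (hneg : Pairwise fun i j => μ.real (B i ∩ B j) ≤ μ.real (B i) * μ.real (B j)) :
    Var[∑ i, (B i).indicator 1; μ] ≤ Fintype.card ι / 4 := by
  classical
  rw [variance_sum fun i => memLp_indicator_one (hB i) 2]
  calc ∑ i, ∑ j, cov[(B i).indicator 1, (B j).indicator 1; μ]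
      ≤ ∑ i, ∑ j, if i = j then 1 / 4 else 0 := by
        refine Finset.sum_le_sum fun i _ => Finset.sum_le_sum fun j _ => ?_
        split_ifs with hij
        · rw [← hij, covariance_self (memLp_indicator_one (hB i) 2).aemeasurable]
          exact variance_indicator_one_le (hB i)
        · rw [covariance_indicator_one (hB i) (hB j), sub_nonpos]
          exact hneg hij
    _ = Fintype.card ι / 4 := by simp [div_eq_mul_inv]

theorem measureReal_lt_integral_sub_le_variance_div_sq {μ : Measure Ω} [IsFiniteMeasure μ]
    {X : Ω → ℝ} (hX : MemLp X 2 μ) {r : ℝ} (hr : 0 < r) :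
    μ.real {ω | X ω < μ[X] - r} ≤ Var[X; μ] / r ^ 2 := by
  have hsub : {ω | X ω < μ[X] - r} ⊆ {ω | r ≤ |X ω - μ[X]|} := fun ω hω => by
    rw [Set.mem_ofPred_eq, abs_sub_comm]
    exact (lt_sub_comm.1 hω).le.trans (le_abs_self _)
  exact ENNReal.toReal_le_of_le_ofReal (div_nonneg (variance_nonneg X μ) (sq_nonneg r))
    ((measure_mono hsub).trans (meas_ge_le_variance_div_sq hX hr))

theorem measureReal_sum_indicator_one_lt_le {ι : Type*} [Fintype ι] [Nonempty ι] {μ : Measure Ω}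
    [IsProbabilityMeasure μ] {B : ι → Set Ω} (hB : ∀ i, MeasurableSet (B i))
    (hneg : Pairwise fun i j => μ.real (B i ∩ B j) ≤ μ.real (B i) * μ.real (B j))
    {q δ : ℝ} (hq : ∀ i, q ≤ μ.real (B i)) (hδ : 0 < δ) :
    μ.real {ω | ∑ i, (B i).indicator 1 ω < Fintype.card ι * (q - δ)} ≤
      1 / (4 * Fintype.card ι * δ ^ 2) := by
  have hmean : Fintype.card ι * q ≤ μ[∑ i, (B i).indicator 1] := by
    simp only [Finset.sum_apply]
    rw [integral_finsetSum _ fun i _ => (memLp_indicator_one (hB i) 1).integrable le_rfl]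
    simp only [integral_indicator_one (hB _)]
    simpa using Finset.card_nsmul_le_sum Finset.univ _ q fun i _ => hq i
  calc μ.real {ω | ∑ i, (B i).indicator 1 ω < Fintype.card ι * (q - δ)}
      ≤ μ.real {ω | (∑ i, (B i).indicator 1) ω <
          μ[∑ i, (B i).indicator 1] - Fintype.card ι * δ} := by
        refine measureReal_mono fun ω hω => ?_
        rw [Set.mem_ofPred_eq, mul_sub] at hω
        rw [Set.mem_ofPred_eq, Finset.sum_apply]
        linarith
    _ ≤ Var[∑ i, (B i).indicator 1; μ] / (Fintype.card ι * δ) ^ 2 :=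
        measureReal_lt_integral_sub_le_variance_div_sq
          (memLp_finsetSum' _ fun i _ => memLp_indicator_one (hB i) 2) (by positivity)
    _ ≤ Fintype.card ι / 4 / (Fintype.card ι * δ) ^ 2 := by
        gcongr
        exact variance_sum_indicator_one_le hB hneg
    _ = 1 / (4 * Fintype.card ι * δ ^ 2) := by field_simp

theorem mul_one_sub_measureReal_lt_le_integral {μ : Measure Ω} [IsProbabilityMeasure μ]
    {X : Ω → ℝ} (hX : Integrable X μ) (hX0 : 0 ≤ X) {κ : ℝ} (hκ : 0 ≤ κ) :
    κ * (1 - μ.real {ω | X ω < κ}) ≤ ∫ ω, X ω ∂μ := by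
  have hcover : {ω | X ω < κ} ∪ {ω | κ ≤ X ω} = Set.univ :=
    Set.eq_univ_of_forall fun ω => lt_or_ge (X ω) κ
  have hone : 1 ≤ μ.real {ω | X ω < κ} + μ.real {ω | κ ≤ X ω} := by
    rw [← probReal_univ (μ := μ), ← hcover]
    exact measureReal_union_le _ _
  calc κ * (1 - μ.real {ω | X ω < κ}) ≤ κ * μ.real {ω | κ ≤ X ω} := by gcongr; linarith
    _ ≤ ∫ ω, X ω ∂μ := mul_meas_ge_le_integral_of_nonneg (Eventually.of_forall hX0) hX κ

theorem integral_le_add_mul_measureReal_lt {μ : Measure Ω} [IsProbabilityMeasure μ] {X : Ω → ℝ}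
    (hX : Measurable X) (hXint : Integrable X μ) {u M : ℝ} (hu : 0 ≤ u) (hXM : ∀ ω, X ω ≤ M) :
    ∫ ω, X ω ∂μ ≤ u + M * μ.real {ω | u < X ω} := by
  have htail : MeasurableSet {ω | u < X ω} := measurableSet_lt measurable_const hX
  have hbound : ∀ ω, X ω ≤ u + {ω | u < X ω}.indicator (fun _ => M) ω := fun ω => by
    by_cases hω : u < X ω
    · rw [Set.indicator_of_mem (show ω ∈ {ω | u < X ω} from hω)]
      linarith [hXM ω]
    · rw [Set.indicator_of_notMem (show ω ∉ {ω | u < X ω} from hω), add_zero]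
      exact not_lt.1 hω
  have hind : Integrable ({ω | u < X ω}.indicator fun _ => M) μ :=
    (integrable_const M).indicator htail
  calc ∫ ω, X ω ∂μ ≤ ∫ ω, (u + {ω | u < X ω}.indicator (fun _ => M) ω) ∂μ :=
        integral_mono hXint ((integrable_const u).add hind) hbound
    _ = u + M * μ.real {ω | u < X ω} := by
        rw [integral_add (integrable_const u) hind, integral_indicator_const M htail]
        simp [mul_comm]

theorem tendsto_measureReal_mem_Icc {β : Type*} {l : Filter β} {Ω : β → Type*}
    [∀ n, MeasurableSpace (Ω n)] {μ : ∀ n, Measure (Ω n)} [∀ n, IsProbabilityMeasure (μ n)]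
    {X : ∀ n, Ω n → ℝ} {a b : ℝ} (ha : Tendsto (fun n => (μ n).real {ω | X n ω < a}) l (𝓝 0))
    (hb : Tendsto (fun n => (μ n).real {ω | b < X n ω}) l (𝓝 0)) :
    Tendsto (fun n => (μ n).real {ω | X n ω ∈ Set.Icc a b}) l (𝓝 1) := by
  have hlim : Tendsto (fun n => 1 - ((μ n).real {ω | X n ω < a} + (μ n).real {ω | b < X n ω})) l
      (𝓝 1) := by simpa using (ha.add hb).const_sub 1
  refine tendsto_of_tendsto_of_tendsto_of_le_of_le hlim tendsto_const_nhds (fun n => ?_)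
    fun n => measureReal_le_one
  have hcover : {ω | X n ω ∈ Set.Icc a b} ∪ ({ω | X n ω < a} ∪ {ω | b < X n ω}) = Set.univ := by
    ext ω
    simp only [Set.mem_union, Set.mem_ofPred_eq, Set.mem_Icc, Set.mem_univ, iff_true]
    grind
  have hone := measureReal_union_le (μ := μ n) {ω | X n ω ∈ Set.Icc a b}
    ({ω | X n ω < a} ∪ {ω | b < X n ω})
  rw [hcover, probReal_univ] at hone
  linarith [measureReal_union_le (μ := μ n) {ω | X n ω < a} {ω | b < X n ω}]

theorem exists_tendsto_zero_forall_le_add {β : Type*} {l : Filter β} {E : β → ℝ} {a : ℝ}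
    (h : ∀ t > a, ∀ᶠ n in l, E n < t) :
    ∃ δ : β → ℝ, Tendsto δ l (𝓝 0) ∧ ∀ n, E n ≤ a + δ n := by
  refine ⟨fun n => max 0 (E n - a), tendsto_order.2 ⟨fun c hc => ?_, fun c hc => ?_⟩, fun n => ?_⟩
  · exact Eventually.of_forall fun n => hc.trans_le (le_max_left _ _)
  · filter_upwards [h (a + c) (by linarith)] with n hn
    exact max_lt hc (by linarith)
  · linarith [le_max_right 0 (E n - a)]

theorem uniformOn_univ_real [Finite Ω] [MeasurableSingletonClass Ω] (s : Set Ω) :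
    (uniformOn Set.univ).real s = s.ncard / Nat.card Ω := by
  cases nonempty_fintype Ω
  rw [measureReal_def, uniformOn_univ, ENNReal.toReal_div, Measure.count_apply_finite s s.toFinite,
    Set.ncard_eq_toFinset_card s]
  simp

/-- The Harris–Kleitman correlation inequality. -/
theorem uniformOn_univ_real_inter_le_mul [DistribLattice Ω] [Finite Ω]
    [MeasurableSingletonClass Ω] {s t : Set Ω} (hs : IsLowerSet s) (ht : IsUpperSet t) :
    (uniformOn Set.univ).real (s ∩ t) ≤
      (uniformOn Set.univ).real s * (uniformOn Set.univ).real t := by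
  classical
  cases nonempty_fintype Ω
  have hcard : (s ∩ t).ncard * Nat.card Ω ≤ s.ncard * t.ncard := by
    simp only [Set.ncard_eq_toFinset_card', Nat.card_eq_fintype_card]
    refine (Finset.le_card_infs_mul_card_sups (s ∩ t).toFinset Finset.univ).trans ?_
    gcongr
    · refine Finset.infs_subset_iff.2 fun a ha b _ => ?_
      exact Set.mem_toFinset.2 (hs inf_le_left (Set.mem_toFinset.1 ha).1)
    · refine Finset.sups_subset_iff.2 fun a ha b _ => ?_
      exact Set.mem_toFinset.2 (ht le_sup_left (Set.mem_toFinset.1 ha).2)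
  rcases isEmpty_or_nonempty Ω with _ | _
  · simp [Set.eq_empty_of_isEmpty]
  · have hpos : (0 : ℝ) < Nat.card Ω := Nat.cast_pos.2 Nat.card_pos
    simp only [uniformOn_univ_real]
    rw [div_mul_div_comm, div_le_div_iff₀ hpos (by positivity), ← mul_assoc]
    exact mul_le_mul_of_nonneg_right (by exact_mod_cast hcard) hpos.le

theorem uniformOn_univ_real_le_of_perm {ι : Type*} [Finite ι] [Nonempty ι] [Finite Ω] [Nonempty Ω]
    [MeasurableSingletonClass Ω] (f : ι → Equiv.Perm Ω) (S : Set Ω) {η : ℝ}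
    (h : ∀ ω, ({i | f i ω ∈ S}.ncard : ℝ) / Nat.card ι ≤ η) :
    (uniformOn Set.univ).real S ≤ η := by
  classical
  cases nonempty_fintype Ω
  cases nonempty_fintype ι
  have hΩ : (0 : ℝ) < Nat.card Ω := Nat.cast_pos.2 Nat.card_pos
  have hι : (0 : ℝ) < Nat.card ι := Nat.cast_pos.2 Nat.card_pos
  have hpreimage : ∀ i, {ω | f i ω ∈ S}.ncard = S.ncard := fun i =>
    Set.ncard_preimage_of_injective_subset_range (f i).injective fun s _ => (f i).surjective s
  have hdouble : ∑ ω, {i | f i ω ∈ S}.ncard = Nat.card ι * S.ncard := by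
    calc ∑ ω, {i | f i ω ∈ S}.ncard = ∑ ω, #{i | f i ω ∈ S} := by
          simp only [Set.ncard_eq_toFinset_card', Set.toFinset_ofPred]
      _ = ∑ i, #{ω | f i ω ∈ S} := Finset.sum_card_bipartiteAbove_eq_sum_card_bipartiteBelow _
      _ = ∑ i, {ω | f i ω ∈ S}.ncard := by
          simp only [Set.ncard_eq_toFinset_card', Set.toFinset_ofPred]
      _ = Nat.card ι * S.ncard := by simp [hpreimage]
  rw [uniformOn_univ_real, div_le_iff₀ hΩ, ← mul_le_mul_iff_right₀ hι]
  calc (Nat.card ι * S.ncard : ℝ) = ∑ ω, ({i | f i ω ∈ S}.ncard : ℝ) := by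
        exact_mod_cast hdouble.symm
    _ ≤ ∑ _ω : Ω, η * Nat.card ι := Finset.sum_le_sum fun ω _ => (div_le_iff₀ hι).1 (h ω)
    _ = Nat.card ι * (η * Nat.card Ω) := by simp; ring

end Probability

section Labelling

open scoped Finset

theorem uniformOn_univ_real_forall_mem_eq {V L : Type*} [Finite V] [Fintype L]
    [MeasurableSpace L] [MeasurableSingletonClass L] (T : Finset V) (i : L) :
    (uniformOn Set.univ).real {c : V → L | ∀ v ∈ T, c v = i} =
      (Fintype.card L : ℝ)⁻¹ ^ #T := by
  cases nonempty_fintype V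
  have : Nonempty L := ⟨i⟩
  have : IsProbabilityMeasure (uniformOn Set.univ : Measure L) :=
    isProbabilityMeasure_uniformOn Set.finite_univ Set.univ_nonempty
  have hpi : {c : V → L | ∀ v ∈ T, c v = i} = (T : Set V).pi fun _ => {i} := by
    ext c
    simp
  rw [hpi, measureReal_def, ← Set.pi_univ Set.univ, uniformOn_pi, Measure.pi_pi_finset]
  simp [uniformOn_univ]

theorem exists_linearOrder_isBot_isTop {α : Type*} {a b : α} (hab : a ≠ b) :
    ∃ _ : LinearOrder α, IsBot a ∧ IsTop b := by
  classical
  let : LinearOrder α := linearOrderOfSTO WellOrderingRel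
  let rank : α → Fin 3 ×ₗ α := fun x => toLex (if x = a then 0 else if x = b then 2 else 1, x)
  have hrank : Function.Injective rank := fun x y hxy => congrArg (fun p => (ofLex p).2) hxy
  refine ⟨LinearOrder.lift' rank hrank, fun x => ?_, fun x => ?_⟩
  · change rank a ≤ rank x
    by_cases hxa : x = a
    · rw [hxa]
    · exact Prod.Lex.toLex_le_toLex.2 (Or.inl (by
        simp only [if_true, if_false, hxa]; split_ifs <;> decide))
  · change rank x ≤ rank b
    by_cases hxb : x = b
    · rw [hxb]
    · exact Prod.Lex.toLex_le_toLex.2 (Or.inl (by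
        simp only [if_true, if_false, hxb, hab.symm]; split_ifs <;> decide))

variable {V L : Type*} [Fintype L] [DecidableEq L] (E : Finset (Finset V))

/-- The labels which a labelling `c` of the vertices of a hypergraph with edge set `E` gives to
all the vertices of some edge. -/
def monochromaticLabels (c : V → L) : Finset L :=
  {i | ∃ e ∈ E, ∀ v ∈ e, c v = i}

variable {E}

theorem mem_monochromaticLabels {c : V → L} {i : L} :
    i ∈ monochromaticLabels E c ↔ ∃ e ∈ E, ∀ v ∈ e, c v = i := by
  simp [monochromaticLabels]

theorem isLowerSet_mem_monochromaticLabels [PartialOrder L] {i : L} (hi : IsBot i) :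
    IsLowerSet {c : V → L | i ∈ monochromaticLabels E c} := fun c c' hc hmem => by
  obtain ⟨e, he, hce⟩ := mem_monochromaticLabels.1 hmem
  exact mem_monochromaticLabels.2
    ⟨e, he, fun v hv => hi.isMin.eq_of_le ((hc v).trans (hce v hv).le)⟩

theorem isUpperSet_mem_monochromaticLabels [PartialOrder L] {i : L} (hi : IsTop i) :
    IsUpperSet {c : V → L | i ∈ monochromaticLabels E c} := fun c c' hc hmem => by
  obtain ⟨e, he, hce⟩ := mem_monochromaticLabels.1 hmem
  exact mem_monochromaticLabels.2
    ⟨e, he, fun v hv => hi.isMax.eq_of_ge ((hce v hv).ge.trans (hc v))⟩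

variable [Finite V] [MeasurableSpace L] [MeasurableSingletonClass L]

/-- In a linear order on the labels with `i` at the bottom and `j` at the top, the two events are a
lower set and an upper set. -/
theorem uniformOn_univ_real_mem_monochromaticLabels_inter_le {i j : L} (hij : i ≠ j) :
    (uniformOn Set.univ).real ({c : V → L | i ∈ monochromaticLabels E c} ∩
        {c | j ∈ monochromaticLabels E c}) ≤
      (uniformOn Set.univ).real {c : V → L | i ∈ monochromaticLabels E c} *
        (uniformOn Set.univ).real {c : V → L | j ∈ monochromaticLabels E c} := by
  obtain ⟨_, hi, hj⟩ := exists_linearOrder_isBot_isTop hij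
  exact uniformOn_univ_real_inter_le_mul (isLowerSet_mem_monochromaticLabels hi)
    (isUpperSet_mem_monochromaticLabels hj)

theorem uniformOn_univ_real_card_monochromaticLabels_lt_le [Nonempty L] {q δ : ℝ} (hδ : 0 < δ)
    (hq : ∀ i, q ≤ (uniformOn Set.univ).real {c : V → L | i ∈ monochromaticLabels E c}) :
    (uniformOn Set.univ).real
        {c : V → L | (#(monochromaticLabels E c) : ℝ) < Fintype.card L * (q - δ)} ≤
      1 / (4 * Fintype.card L * δ ^ 2) := by
  have : IsProbabilityMeasure (uniformOn Set.univ : Measure (V → L)) :=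
    isProbabilityMeasure_uniformOn Set.finite_univ Set.univ_nonempty
  have hcount : ∀ c : V → L, (#(monochromaticLabels E c) : ℝ) =
      ∑ i, {c : V → L | i ∈ monochromaticLabels E c}.indicator 1 c := fun c => by
    simp [Set.indicator_apply]
  simp only [hcount]
  exact measureReal_sum_indicator_one_lt_le (fun i => (Set.toFinite _).measurableSet)
    (fun i j => uniformOn_univ_real_mem_monochromaticLabels_inter_le) hq hδ

theorem sq_sum_inv_card_pow_le [DecidableEq V] (i : L) :
    (∑ e ∈ E, (Fintype.card L : ℝ)⁻¹ ^ #e) ^ 2 ≤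
      (∑ e ∈ E, ∑ f ∈ E, (Fintype.card L : ℝ)⁻¹ ^ #(e ∪ f)) *
        (uniformOn Set.univ).real {c : V → L | i ∈ monochromaticLabels E c} := by
  have hevent : {c : V → L | i ∈ monochromaticLabels E c} =
      ⋃ e ∈ E, {c : V → L | ∀ v ∈ e, c v = i} := by
    ext c
    simp [mem_monochromaticLabels]
  have hinter : ∀ e f : Finset V, {c : V → L | ∀ v ∈ e, c v = i} ∩ {c | ∀ v ∈ f, c v = i} =
      {c | ∀ v ∈ e ∪ f, c v = i} := fun e f => by
    ext c
    simp [or_imp, forall_and]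
  rw [hevent]
  simp only [← uniformOn_univ_real_forall_mem_eq _ i, ← hinter]
  exact sq_sum_measureReal_le_measureReal_biUnion_mul E fun e => (Set.toFinite _).measurableSet

end Labelling

section CountingPermutations

theorem eq_and_eq_of_strictMono_of_comp_perm_eq {ι α : Type*} [LinearOrder ι] [WellFoundedLT ι]
    [PartialOrder α] {f g : ι → α} (hf : StrictMono f)
    (hg : StrictMono g) {τ τ' : Equiv.Perm ι} (h : f ∘ τ = g ∘ τ') : f = g ∧ τ = τ' := by
  have hfg : f = g := by
    rw [← StrictMono.range_inj hf hg, ← EquivLike.range_comp f τ, h, EquivLike.range_comp]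
  subst hfg
  exact ⟨rfl, Equiv.ext fun a => hf.injective (congrFun h a)⟩

variable {ι α : Type*} [Finite ι] [LinearOrder ι] [Finite α] [PartialOrder α]

theorem ncard_strictMono_comp_mul_factorial_le (t : ι → α) :
    {σ : Equiv.Perm α | StrictMono (σ ∘ t)}.ncard * (Nat.card ι).factorial ≤
      (Nat.card α).factorial := by
  by_cases ht : Function.Injective t
  · have := Fintype.ofFinite ι
    have := Classical.decEq α
    rw [← Nat.card_perm, ← Nat.card_perm, ← Nat.card_coe_set_eq, ← Nat.card_prod]
    refine Nat.card_le_card_of_injective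
      (fun p => (p.1 : Equiv.Perm α) * p.2.viaFintypeEmbedding ⟨t, ht⟩) ?_
    rintro ⟨⟨σ, hσ⟩, τ⟩ ⟨⟨σ', hσ'⟩, τ'⟩ h
    have hcomp : (σ ∘ t) ∘ τ = (σ' ∘ t) ∘ τ' := funext fun a => by
      have hext : ∀ τ : Equiv.Perm ι, τ.viaFintypeEmbedding ⟨t, ht⟩ (t a) = t (τ a) := fun τ =>
        Equiv.Perm.viaFintypeEmbedding_apply_image τ ⟨t, ht⟩ a
      simpa only [Equiv.Perm.mul_apply, Function.comp_apply, hext] using Equiv.congr_fun h (t a)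
    obtain ⟨-, rfl⟩ := eq_and_eq_of_strictMono_of_comp_perm_eq hσ hσ' hcomp
    simpa using h
  · have hempty : {σ : Equiv.Perm α | StrictMono (σ ∘ t)} = ∅ :=
      Set.eq_empty_of_forall_notMem fun σ hσ => ht hσ.injective.of_comp
    simp [hempty]

theorem ncard_strictMono_or_strictAnti_comp_mul_factorial_le (t : ι → α) :
    {σ : Equiv.Perm α | StrictMono (σ ∘ t) ∨ StrictAnti (σ ∘ t)}.ncard *
      (Nat.card ι).factorial ≤ 2 * (Nat.card α).factorial := by
  have hmono := ncard_strictMono_comp_mul_factorial_le t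
  have hanti := ncard_strictMono_comp_mul_factorial_le (t ∘ OrderDual.ofDual)
  have hdual : {σ : Equiv.Perm α | StrictMono (σ ∘ t ∘ OrderDual.ofDual)} =
      {σ : Equiv.Perm α | StrictAnti (σ ∘ t)} :=
    Set.ext fun σ => strictMono_comp_ofDual_iff (f := σ ∘ t)
  rw [hdual, Nat.card_congr OrderDual.ofDual] at hanti
  calc _ ≤ ({σ : Equiv.Perm α | StrictMono (σ ∘ t)}.ncard +
        {σ : Equiv.Perm α | StrictAnti (σ ∘ t)}.ncard) * (Nat.card ι).factorial := by
        gcongr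
        exact Set.ncard_union_le _ _
    _ ≤ 2 * (Nat.card α).factorial := by linarith

end CountingPermutations

theorem pow_div_factorial_le_exp_of_mul_le {u y : ℝ} (hu : 0 < u) (hy : 0 ≤ y) {m : ℕ}
    (h : u * y ≤ m) : y ^ m / m.factorial ≤ Real.exp (-((Real.log u - 1) * m)) := by
  calc y ^ m / m.factorial = (u * y) ^ m / m.factorial / u ^ m := by
        rw [mul_pow]
        field_simp
    _ ≤ (m : ℝ) ^ m / m.factorial / u ^ m := by gcongr
    _ ≤ Real.exp m / u ^ m := by
        gcongr
        exact Real.pow_div_factorial_le_exp _ m.cast_nonneg m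
    _ = Real.exp (-((Real.log u - 1) * m)) := by
        nth_rw 1 [← Real.exp_log hu]
        rw [← Real.exp_nat_mul, ← Real.exp_sub]
        ring_nf

section Graph

open scoped Finset

variable {ι α : Type*} [Fintype ι] [DecidableEq ι] [DecidableEq α]

/-- The graph of a function, as a finite set of argument-value pairs. -/
def graphFinset (x : ι → α) : Finset (ι × α) :=
  Finset.univ.image fun j => (j, x j)

theorem mem_graphFinset {x : ι → α} {a : ι × α} : a ∈ graphFinset x ↔ x a.1 = a.2 := by
  simp [graphFinset, Prod.ext_iff]

theorem forall_mem_graphFinset {x : ι → α} {p : ι × α → Prop} :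
    (∀ a ∈ graphFinset x, p a) ↔ ∀ j, p (j, x j) := by
  simp [graphFinset]

theorem graphFinset_injective : Function.Injective (graphFinset : (ι → α) → Finset (ι × α)) :=
  fun x y hxy => funext fun j => by
    have hmem : (j, y j) ∈ graphFinset x := hxy ▸ mem_graphFinset.2 rfl
    exact mem_graphFinset.1 hmem

theorem card_graphFinset (x : ι → α) : #(graphFinset x) = Fintype.card ι :=
  Finset.card_image_of_injective _ fun _ _ h => congrArg Prod.fst h

theorem card_graphFinset_union_add (x y : ι → α) :
    #(graphFinset x ∪ graphFinset y) + #{j | y j = x j} = 2 * Fintype.card ι := by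
  have hinter : #(graphFinset x ∩ graphFinset y) = #{j | y j = x j} := by
    have himage : (graphFinset x ∩ graphFinset y).image Prod.fst =
        ({j | y j = x j} : Finset ι) := by
      ext j
      simp [mem_graphFinset, eq_comm]
    rw [← himage, Finset.card_image_of_injOn]
    intro a ha b hb hab
    simp only [Finset.coe_inter, Set.mem_inter_iff, Finset.mem_coe, mem_graphFinset] at ha hb
    exact Prod.ext hab (by rw [← ha.1, ← hb.1, hab])
  rw [← hinter, Finset.card_union_add_card_inter, card_graphFinset, card_graphFinset, two_mul]

end Graph

theorem IsHDPerm.comp_perm {n k : ℕ} {A : (Fin (k + 1) → Fin n) → Fin 2} (hA : IsHDPerm A)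
    (π : Fin (k + 1) → Equiv.Perm (Fin n)) : IsHDPerm fun x => A fun j => π j (x j) := by
  intro j x
  have hupdate : ∀ t, (fun i => π i (Function.update x j t i)) =
      Function.update (fun i => π i (x i)) j (π j t) := fun t =>
    funext (Function.apply_update (fun i => π i) x j t)
  simp only [hupdate]
  exact (π j).bijective.existsUnique_iff.1 (hA j fun i => π i (x i))

theorem isHDPerm_sum_eq_zero {n k : ℕ} [NeZero n] :
    IsHDPerm fun x : Fin (k + 1) → Fin n => if ∑ j, x j = 0 then 1 else 0 := by
  intro j x
  have hsum : ∀ t, ∑ i, Function.update x j t i = t + ∑ i ∈ Finset.univ \ {j}, x i :=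
    Finset.sum_update_of_mem (Finset.mem_univ j) x
  refine ⟨-∑ i ∈ Finset.univ \ {j}, x i, ?_, fun t ht => ?_⟩
  · simp only [hsum, neg_add_cancel, if_true]
  · exact eq_neg_of_add_eq_zero_left (by simpa [hsum] using ht)

namespace HDPerm

open scoped Finset

variable {n k : ℕ}

instance : MeasurableSingletonClass (HDPerm n k) := ⟨fun _ => trivial⟩

instance : Nonempty (HDPerm n k) := by
  rcases Nat.eq_zero_or_pos n with rfl | hn
  · exact ⟨fun _ => 0, fun _ x => (x 0).elim0⟩
  · have : NeZero n := ⟨hn.ne'⟩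
    exact ⟨_, isHDPerm_sum_eq_zero⟩

instance : IsProbabilityMeasure (unif n k) :=
  isProbabilityMeasure_uniformOn Set.finite_univ Set.univ_nonempty

theorem eq_of_mem_support {A : HDPerm n k} {x y : Fin (k + 1) → Fin n} (hx : x ∈ A.support)
    (hy : y ∈ A.support) (j : Fin (k + 1)) (h : ∀ i, i ≠ j → x i = y i) : x = y := by
  have hxy : Function.update y j (x j) = x :=
    Function.update_eq_iff.2 ⟨rfl, fun i hi => (h i hi).symm⟩
  have hline : x j = y j := (A.2 j y).unique (y₁ := x j) (y₂ := y j)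
    (by rw [hxy]; exact hx) (by rw [Function.update_eq_self]; exact hy)
  rw [← hxy, hline, Function.update_eq_self]

/-- The support as a finite set. -/
def supportFinset (A : HDPerm n k) : Finset (Fin (k + 1) → Fin n) :=
  {x | A.1 x = 1}

theorem mem_supportFinset {A : HDPerm n k} {x : Fin (k + 1) → Fin n} :
    x ∈ A.supportFinset ↔ x ∈ A.support := by
  simp [supportFinset, support]

theorem card_supportFinset (hn : 0 < n) (A : HDPerm n k) : #A.supportFinset = n ^ k := by
  have hcard : #(Finset.univ : Finset (Fin k → Fin n)) = n ^ k := by simp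
  rw [← hcard]
  refine Finset.card_bij (fun x _ => Fin.tail x) (fun _ _ => Finset.mem_univ _)
    (fun x hx y hy hxy => ?_) fun r _ => ?_
  · refine eq_of_mem_support (mem_supportFinset.1 hx) (mem_supportFinset.1 hy) 0 fun i hi => ?_
    obtain ⟨i, rfl⟩ := Fin.exists_succ_eq.2 hi
    exact congrFun hxy i
  · obtain ⟨t, ht, -⟩ := A.2 0 (Fin.cons ⟨0, hn⟩ r)
    refine ⟨Fin.cons t r, mem_supportFinset.2 ?_, Fin.tail_cons _ _⟩
    simpa [support] using ht

theorem card_filter_supportFinset_mul_le (A : HDPerm n k) (x : Fin (k + 1) → Fin n)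
    {S : Finset (Fin (k + 1))} (hS : S ≠ Finset.univ) :
    #{y ∈ A.supportFinset | ∀ j ∈ S, y j = x j} * n ^ #S ≤ n ^ k := by
  obtain ⟨j, hj⟩ : ∃ j, j ∉ S := by simpa [Finset.eq_univ_iff_forall] using hS
  have hfree : #(insert j S)ᶜ + #S = k := by
    have := Finset.card_compl_add_card (insert j S)
    rw [Finset.card_insert_of_notMem hj, Fintype.card_fin] at this
    omega
  have hcard : #{y ∈ A.supportFinset | ∀ j ∈ S, y j = x j} ≤ n ^ #(insert j S)ᶜ := by
    calc #{y ∈ A.supportFinset | ∀ j ∈ S, y j = x j}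
        ≤ #(Finset.univ : Finset (((insert j S)ᶜ : Finset (Fin (k + 1))) → Fin n)) := by
          refine Finset.card_le_card_of_injOn (fun y i => y i) (fun _ _ => Finset.mem_univ _)
            fun y hy z hz hyz => ?_
          simp only [Finset.coe_filter, Set.mem_ofPred_eq, mem_supportFinset] at hy hz
          refine eq_of_mem_support hy.1 hz.1 j fun i hi => ?_
          by_cases hiS : i ∈ S
          · rw [hy.2 i hiS, hz.2 i hiS]
          · exact congrFun hyz ⟨i, by simp [hi, hiS]⟩
      _ = n ^ #(insert j S)ᶜ := by
          rw [Finset.card_univ, Fintype.card_fun, Fintype.card_fin, Fintype.card_coe]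
  calc _ ≤ n ^ #(insert j S)ᶜ * n ^ #S := by gcongr
    _ = n ^ k := by rw [← pow_add, hfree]

theorem card_filter_supportFinset_mul_pow_le (hn : 0 < n) (A : HDPerm n k)
    (x : Fin (k + 1) → Fin n) {t : ℝ} (ht : 0 ≤ t) (S : Finset (Fin (k + 1))) :
    #{y ∈ A.supportFinset | ∀ j ∈ S, y j = x j} * t ^ #S ≤
      (if S = Finset.univ then t ^ (k + 1) else 0) + (n : ℝ) ^ k * (t / n) ^ #S := by
  split_ifs with hS
  · have hone : #{y ∈ A.supportFinset | ∀ j ∈ S, y j = x j} ≤ 1 :=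
      Finset.card_le_one.2 fun y hy z hz => by
        simp only [hS, Finset.mem_filter, Finset.mem_univ, true_imp_iff] at hy hz
        exact funext fun j => (hy.2 j).trans (hz.2 j).symm
    have hpow : t ^ #S = t ^ (k + 1) := by simp [hS]
    rw [hpow]
    exact le_add_of_le_of_nonneg
      (mul_le_of_le_one_left (by positivity) (by exact_mod_cast hone)) (by positivity)
  · have hcard : (#{y ∈ A.supportFinset | ∀ j ∈ S, y j = x j} : ℝ) * (n : ℝ) ^ #S ≤
        (n : ℝ) ^ k := by exact_mod_cast card_filter_supportFinset_mul_le A x hS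
    rw [zero_add, div_pow, ← mul_div_assoc, le_div_iff₀ (by positivity), mul_right_comm]
    gcongr

theorem sum_pow_card_agree_le (hn : 0 < n) (A : HDPerm n k) (x : Fin (k + 1) → Fin n) {t : ℝ}
    (ht : 0 ≤ t) :
    ∑ y ∈ A.supportFinset, t ^ #{j | y j = x j} ≤
      t ^ (k + 1) + (n : ℝ) ^ k * (1 + t / n) ^ (k + 1) := by
  calc ∑ y ∈ A.supportFinset, t ^ #{j | y j = x j}
      ≤ ∑ y ∈ A.supportFinset, ∑ S : Finset (Fin (k + 1)),
          if ∀ j ∈ S, y j = x j then t ^ #S else 0 := by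
        refine Finset.sum_le_sum fun y _ => ?_
        refine le_trans (le_of_eq ?_) (Finset.single_le_sum (fun S _ => by positivity)
          (Finset.mem_univ ({j | y j = x j} : Finset (Fin (k + 1)))))
        simp
    _ = ∑ S : Finset (Fin (k + 1)),
          (#{y ∈ A.supportFinset | ∀ j ∈ S, y j = x j} : ℝ) * t ^ #S := by
        rw [Finset.sum_comm]
        simp only [← Finset.sum_filter, Finset.sum_const, nsmul_eq_mul]
    _ ≤ ∑ S : Finset (Fin (k + 1)),
          ((if S = Finset.univ then t ^ (k + 1) else 0) + (n : ℝ) ^ k * (t / n) ^ #S) :=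
        Finset.sum_le_sum fun S _ => card_filter_supportFinset_mul_pow_le hn A x ht S
    _ = t ^ (k + 1) + (n : ℝ) ^ k * (1 + t / n) ^ (k + 1) := by
        have hbinom := Fintype.sum_pow_mul_eq_add_pow (Fin (k + 1)) (t / n) 1
        simp only [one_pow, mul_one, Fintype.card_fin] at hbinom
        rw [Finset.sum_add_distrib, ← Finset.mul_sum, hbinom, add_comm 1]
        simp

theorem sum_sum_inv_pow_card_graphFinset_union_le (hn : 0 < n) (A : HDPerm n k) {t : ℝ}
    (ht : 0 < t) :
    ∑ x ∈ A.supportFinset, ∑ y ∈ A.supportFinset, t⁻¹ ^ #(graphFinset x ∪ graphFinset y) ≤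
      n ^ k * (t⁻¹ ^ (2 * (k + 1)) * (t ^ (k + 1) + n ^ k * (1 + t / n) ^ (k + 1))) := by
  have hunion : ∀ x y : Fin (k + 1) → Fin n, t⁻¹ ^ #(graphFinset x ∪ graphFinset y) =
      t⁻¹ ^ (2 * (k + 1)) * t ^ #{j | y j = x j} := fun x y => by
    have hcard := card_graphFinset_union_add x y
    rw [Fintype.card_fin] at hcard
    rw [← hcard, pow_add, mul_assoc, ← mul_pow, inv_mul_cancel₀ ht.ne', one_pow, mul_one]
  simp only [hunion]
  calc ∑ x ∈ A.supportFinset, ∑ y ∈ A.supportFinset, t⁻¹ ^ (2 * (k + 1)) * t ^ #{j | y j = x j}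
      ≤ ∑ _x ∈ A.supportFinset,
          t⁻¹ ^ (2 * (k + 1)) * (t ^ (k + 1) + n ^ k * (1 + t / n) ^ (k + 1)) := by
        gcongr with x
        rw [← Finset.mul_sum]
        gcongr
        exact sum_pow_card_agree_le hn A x ht.le
    _ = n ^ k * (t⁻¹ ^ (2 * (k + 1)) * (t ^ (k + 1) + n ^ k * (1 + t / n) ^ (k + 1))) := by
        simp [card_supportFinset hn]

/-- The hypergraph on the coordinate-value pairs `(j, a)` whose edges are the graphs of the points
of the support. -/
def supportHypergraph (A : HDPerm n k) : Finset (Finset (Fin (k + 1) × Fin n)) :=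
  A.supportFinset.image graphFinset

theorem le_uniformOn_univ_real_mem_monochromaticLabels {L : Type*} [Fintype L] [DecidableEq L]
    [MeasurableSpace L] [MeasurableSingletonClass L] (hn : 0 < n) (A : HDPerm n k) (i : L) :
    (n : ℝ) ^ k / ((Fintype.card L : ℝ) ^ (k + 1) +
        (n : ℝ) ^ k * (1 + (Fintype.card L : ℝ) / n) ^ (k + 1)) ≤
      (uniformOn Set.univ).real {c : Fin (k + 1) × Fin n → L |
        i ∈ monochromaticLabels A.supportHypergraph c} := by
  set N : ℝ := (Fintype.card L : ℝ)
  set D : ℝ := N ^ (k + 1) + (n : ℝ) ^ k * (1 + N / n) ^ (k + 1)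
  set p : ℝ := (uniformOn Set.univ).real {c : Fin (k + 1) × Fin n → L |
        i ∈ monochromaticLabels A.supportHypergraph c}
  have hN : 0 < N := Nat.cast_pos.2 (Fintype.card_pos_iff.2 ⟨i⟩)
  have hsecond := sq_sum_inv_card_pow_le (E := A.supportHypergraph) i
  simp only [supportHypergraph, Finset.sum_image graphFinset_injective.injOn, card_graphFinset,
    Fintype.card_fin, Finset.sum_const, card_supportFinset hn, nsmul_eq_mul, Nat.cast_pow]
    at hsecond
  rw [div_le_iff₀' (by positivity)]
  refine le_of_mul_le_mul_left (a := (n : ℝ) ^ k * N⁻¹ ^ (2 * (k + 1))) ?_ (by positivity)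
  calc (n : ℝ) ^ k * N⁻¹ ^ (2 * (k + 1)) * n ^ k = (n ^ k * N⁻¹ ^ (k + 1)) ^ 2 := by ring
    _ ≤ (n ^ k * (N⁻¹ ^ (2 * (k + 1)) * D)) * p :=
        hsecond.trans (mul_le_mul_of_nonneg_right
          (sum_sum_inv_pow_card_graphFinset_union_le hn A hN) measureReal_nonneg)
    _ = n ^ k * N⁻¹ ^ (2 * (k + 1)) * (D * p) := by ring

/-- Relabelling the values of each coordinate `j` by the permutation `π j`. -/
def permute (π : Fin (k + 1) → Equiv.Perm (Fin n)) : Equiv.Perm (HDPerm n k) where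
  toFun A := ⟨_, A.2.comp_perm fun j => (π j).symm⟩
  invFun A := ⟨_, A.2.comp_perm π⟩
  left_inv A := Subtype.ext (by simp)
  right_inv A := Subtype.ext (by simp)

theorem mem_support_permute {π : Fin (k + 1) → Equiv.Perm (Fin n)} {A : HDPerm n k}
    {x : Fin (k + 1) → Fin n} :
    x ∈ (permute π A).support ↔ (fun j => (π j).symm (x j)) ∈ A.support :=
  Iff.rfl

theorem le_longestMonotone (A : HDPerm n k) {m : ℕ} {s : Fin m → Fin (k + 1) → Fin n}
    (hs : A.IsMonotoneSubseq s) : m ≤ A.longestMonotone :=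
  le_csSup A.bddAbove_lengths ⟨s, hs⟩

theorem exists_isMonotoneSubseq_of_le (A : HDPerm n k) {m : ℕ} (hm : m ≤ A.longestMonotone) :
    ∃ s : Fin m → Fin (k + 1) → Fin n, A.IsMonotoneSubseq s := by
  have hne : {m : ℕ | ∃ s : Fin m → Fin (k + 1) → Fin n, A.IsMonotoneSubseq s}.Nonempty :=
    ⟨0, fun i => i.elim0, fun i => i.elim0, fun j => Or.inl fun i => i.elim0⟩
  obtain ⟨s, hs, hmono⟩ := Nat.sSup_mem hne A.bddAbove_lengths
  have hcast : StrictMono (Fin.castLE hm) := Fin.strictMono_castLE hm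
  exact ⟨fun i => s (Fin.castLE hm i), fun i => hs _,
    fun j => (hmono j).imp (fun h => h.comp hcast) fun h => h.comp_strictMono hcast⟩

theorem longestMonotone_le (A : HDPerm n k) : A.longestMonotone ≤ n := by
  obtain ⟨s, -, hs⟩ := A.exists_isMonotoneSubseq_of_le le_rfl
  have hinj : Function.Injective fun i => s i 0 := (hs 0).elim (·.injective) (·.injective)
  simpa using Fintype.card_le_of_injective _ hinj

section SortPerm

variable {L : Type*} [LinearOrder L]

/-- The permutations which sort the values of each coordinate by increasing labels. -/
def sortPerm (c : Fin (k + 1) × Fin n → L) (j : Fin (k + 1)) : Equiv.Perm (Fin n) :=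
  (Tuple.sort fun a => c (j, a)).symm

theorem sortPerm_lt_sortPerm {c : Fin (k + 1) × Fin n → L} {j : Fin (k + 1)} {a b : Fin n}
    (h : c (j, a) < c (j, b)) : sortPerm c j a < sortPerm c j b := by
  by_contra! hle
  have hmono := Tuple.monotone_sort (fun a => c (j, a)) hle
  simp only [sortPerm, Function.comp_apply, Equiv.apply_symm_apply] at hmono
  exact hmono.not_gt h

theorem card_monochromaticLabels_le_longestMonotone [Fintype L] (A : HDPerm n k)
    (c : Fin (k + 1) × Fin n → L) :
    #(monochromaticLabels A.supportHypergraph c) ≤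
      (permute (sortPerm c) A).longestMonotone := by
  set label := (monochromaticLabels A.supportHypergraph c).orderEmbOfFin rfl
  have hpoint : ∀ l, ∃ x ∈ A.support, ∀ j, c (j, x j) = label l := fun l => by
    obtain ⟨e, he, hce⟩ := mem_monochromaticLabels.1 (Finset.orderEmbOfFin_mem _ rfl l)
    obtain ⟨x, hx, rfl⟩ := Finset.mem_image.1 he
    exact ⟨x, mem_supportFinset.1 hx, forall_mem_graphFinset.1 hce⟩
  choose x hx hxc using hpoint
  refine le_longestMonotone _ (s := fun l j => sortPerm c j (x l j))
    ⟨fun l => ?_, fun j => Or.inl fun l l' hl => sortPerm_lt_sortPerm ?_⟩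
  · simpa only [mem_support_permute, Equiv.symm_apply_apply] using hx l
  · rw [hxc, hxc]
    exact label.strictMono hl

end SortPerm

theorem unif_real_longestMonotone_lt_le (hn : 0 < n) {N : ℕ} (hN : 0 < N) {δ : ℝ} (hδ : 0 < δ) :
    (unif n k).real {A | (A.longestMonotone : ℝ) < N * ((n : ℝ) ^ k /
      ((N : ℝ) ^ (k + 1) + (n : ℝ) ^ k * (1 + (N : ℝ) / n) ^ (k + 1)) - δ)} ≤
      1 / (4 * N * δ ^ 2) := by
  have : Nonempty (Fin N) := ⟨⟨0, hN⟩⟩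
  refine uniformOn_univ_real_le_of_perm
    (fun c : Fin (k + 1) × Fin n → Fin N => permute (sortPerm c)) _ fun A => ?_
  rw [← uniformOn_univ_real]
  have hlabels := uniformOn_univ_real_card_monochromaticLabels_lt_le (L := Fin N) hδ
    fun i => le_uniformOn_univ_real_mem_monochromaticLabels hn A i
  rw [Fintype.card_fin] at hlabels
  refine (measureReal_mono fun c
    (hc : ((permute (sortPerm c) A).longestMonotone : ℝ) < _) => ?_).trans hlabels
  exact (Nat.cast_le.2 (card_monochromaticLabels_le_longestMonotone A c)).trans_lt hc

theorem setOf_le_longestMonotone_permute_subset (A : HDPerm n k) (m : ℕ) :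
    {π : Fin (k + 1) → Equiv.Perm (Fin n) | m ≤ (permute π A).longestMonotone} ⊆
      ⋃ s ∈ Fintype.piFinset fun _ : Fin m => A.supportFinset, Set.univ.pi fun j =>
        {σ : Equiv.Perm (Fin n) | StrictMono (σ ∘ fun i => s i j) ∨
          StrictAnti (σ ∘ fun i => s i j)} := fun π hπ => by
  obtain ⟨s, hs, hmono⟩ := exists_isMonotoneSubseq_of_le _ hπ
  refine Set.mem_iUnion₂.2 ⟨fun i j => (π j).symm (s i j), ?_, fun j _ => ?_⟩
  · exact Fintype.mem_piFinset.2 fun i => mem_supportFinset.2 (mem_support_permute.1 (hs i))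
  · simpa [Function.comp_def] using hmono j

theorem ncard_le_longestMonotone_permute_mul_le (hn : 0 < n) (A : HDPerm n k) (m : ℕ) :
    {π : Fin (k + 1) → Equiv.Perm (Fin n) | m ≤ (permute π A).longestMonotone}.ncard *
      m.factorial ^ (k + 1) ≤ (n ^ k) ^ m * (2 * n.factorial) ^ (k + 1) := by
  set good : (Fin m → Fin (k + 1) → Fin n) → Fin (k + 1) → Set (Equiv.Perm (Fin n)) :=
    fun s j => {σ | StrictMono (σ ∘ fun i => s i j) ∨ StrictAnti (σ ∘ fun i => s i j)}
  have hgood : ∀ s, (Set.univ.pi (good s)).ncard * m.factorial ^ (k + 1) ≤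
      (2 * n.factorial) ^ (k + 1) := fun s => by
    rw [← Nat.card_coe_set_eq, Nat.card_congr (Equiv.Set.univPi (good s)), Nat.card_pi,
      ← Fin.prod_const, ← Fin.prod_const, ← Finset.prod_mul_distrib]
    refine Finset.prod_le_prod' fun j _ => ?_
    simpa only [Nat.card_fin, Nat.card_coe_set_eq] using
      ncard_strictMono_or_strictAnti_comp_mul_factorial_le fun i => s i j
  calc _ ≤ (∑ s ∈ Fintype.piFinset fun _ : Fin m => A.supportFinset,
          (Set.univ.pi (good s)).ncard) * m.factorial ^ (k + 1) := by
        gcongr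
        exact (Set.ncard_le_ncard (setOf_le_longestMonotone_permute_subset A m)).trans
          (Finset.set_ncard_biUnion_le _ _)
    _ ≤ ∑ _s ∈ Fintype.piFinset fun _ : Fin m => A.supportFinset,
          (2 * n.factorial) ^ (k + 1) := by
        rw [Finset.sum_mul]
        exact Finset.sum_le_sum fun s _ => hgood s
    _ = (n ^ k) ^ m * (2 * n.factorial) ^ (k + 1) := by
        simp [Fintype.card_piFinset, card_supportFinset hn]

theorem unif_real_le_longestMonotone_le (hn : 0 < n) (m : ℕ) :
    (unif n k).real {A | m ≤ A.longestMonotone} ≤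
      2 ^ (k + 1) * ((n : ℝ) ^ k) ^ m / (m.factorial : ℝ) ^ (k + 1) := by
  refine uniformOn_univ_real_le_of_perm permute _ fun A => ?_
  have hcount : ({π | m ≤ (permute π A).longestMonotone}.ncard : ℝ) *
      (m.factorial : ℝ) ^ (k + 1) ≤ ((n : ℝ) ^ k) ^ m * (2 * n.factorial) ^ (k + 1) := by
    exact_mod_cast ncard_le_longestMonotone_permute_mul_le hn A m
  have hcard : (Nat.card (Fin (k + 1) → Equiv.Perm (Fin n)) : ℝ) =
      (n.factorial : ℝ) ^ (k + 1) := by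
    rw [Nat.card_pi, Fin.prod_const, Nat.card_perm, Nat.card_fin, Nat.cast_pow]
  have hfactorial : ∀ i : ℕ, (0 : ℝ) < (i.factorial : ℝ) ^ (k + 1) := fun i => by positivity
  rw [hcard, div_le_div_iff₀ (hfactorial n) (hfactorial m)]
  refine hcount.trans_eq ?_
  rw [mul_pow]
  ring

/-- The order of magnitude `n ^ (k / (k + 1))` of the longest monotone subsequence. -/
noncomputable def growth (k n : ℕ) : ℝ :=
  (n : ℝ) ^ ((k : ℝ) / (k + 1))

theorem growth_pow_add_one (k n : ℕ) : growth k n ^ (k + 1) = (n : ℝ) ^ k := by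
  rw [growth, ← Real.rpow_natCast, ← Real.rpow_mul n.cast_nonneg, Nat.cast_add_one,
    div_mul_cancel₀ _ (by positivity), Real.rpow_natCast]

theorem growth_pos (hn : 0 < n) : 0 < growth k n :=
  Real.rpow_pos_of_pos (Nat.cast_pos.2 hn) _

theorem tendsto_growth (hk : 1 ≤ k) : Tendsto (growth k) atTop atTop :=
  (tendsto_rpow_atTop (by positivity)).comp tendsto_natCast_atTop_atTop

theorem tendsto_growth_div (k : ℕ) : Tendsto (fun n : ℕ => growth k n / n) atTop (𝓝 0) := by
  have hlim : Tendsto (fun n : ℕ => (n : ℝ) ^ (-(1 / ((k : ℝ) + 1)))) atTop (𝓝 0) :=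
    (tendsto_rpow_neg_atTop (by positivity)).comp tendsto_natCast_atTop_atTop
  refine hlim.congr' ?_
  filter_upwards [eventually_gt_atTop 0] with n hn
  rw [growth, ← Real.rpow_sub_one (by positivity)]
  congr 1
  field_simp
  ring

theorem scaledLongest_eq_div (A : HDPerm n k) :
    A.scaledLongest = A.longestMonotone / growth k n := by
  rw [scaledLongest, growth, Real.rpow_neg n.cast_nonneg, ← div_eq_mul_inv]

theorem scaledLongest_nonneg (A : HDPerm n k) : 0 ≤ A.scaledLongest := by
  rw [scaledLongest]
  positivity

theorem scaledLongest_le (A : HDPerm n k) : A.scaledLongest ≤ n := by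
  rcases n.eq_zero_or_pos with rfl | hn
  · have hzero : A.longestMonotone = 0 := Nat.le_zero.1 A.longestMonotone_le
    simp [scaledLongest, hzero]
  · rw [scaledLongest_eq_div]
    exact (div_le_self (Nat.cast_nonneg _) (Real.one_le_rpow (by exact_mod_cast hn)
      (by positivity))).trans (Nat.cast_le.2 A.longestMonotone_le)

theorem unif_real_lt_scaledLongest_le (hn : 0 < n) {u : ℝ} (hu : Real.exp 1 ≤ u) :
    (unif n k).real {A | u < A.scaledLongest} ≤
      2 ^ (k + 1) * Real.exp (-((Real.log u - 1) * growth k n)) := by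
  have hu1 : 1 ≤ u := (Real.one_le_exp zero_le_one).trans hu
  have hlog : 0 ≤ Real.log u - 1 := sub_nonneg.2 ((Real.le_log_iff_exp_le (by positivity)).2 hu)
  have hy : 0 < growth k n := growth_pos hn
  set m : ℕ := ⌈u * growth k n⌉₊
  have hm : u * growth k n ≤ m := Nat.le_ceil _
  have hym : growth k n ≤ m := (le_mul_of_one_le_left hy.le hu1).trans hm
  have hsub : {A : HDPerm n k | u < A.scaledLongest} ⊆ {A | m ≤ A.longestMonotone} := fun A hA => by
    rw [Set.mem_ofPred_eq, scaledLongest_eq_div, lt_div_iff₀ hy] at hA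
    exact Nat.ceil_le.2 hA.le
  calc (unif n k).real {A | u < A.scaledLongest} ≤ (unif n k).real {A | m ≤ A.longestMonotone} :=
        measureReal_mono hsub
    _ ≤ 2 ^ (k + 1) * ((n : ℝ) ^ k) ^ m / (m.factorial : ℝ) ^ (k + 1) :=
        unif_real_le_longestMonotone_le hn m
    _ = 2 ^ (k + 1) * (growth k n ^ m / m.factorial) ^ (k + 1) := by
        rw [← growth_pow_add_one, div_pow, ← pow_mul, ← pow_mul, mul_comm (k + 1) m, mul_div_assoc]
    _ ≤ 2 ^ (k + 1) * Real.exp (-((Real.log u - 1) * m)) ^ (k + 1) := by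
        gcongr
        exact pow_div_factorial_le_exp_of_mul_le (by positivity) hy.le hm
    _ ≤ 2 ^ (k + 1) * Real.exp (-((Real.log u - 1) * m)) := by
        gcongr
        exact pow_le_of_le_one (Real.exp_nonneg _) (Real.exp_le_one_iff.2
          (neg_nonpos.2 (by positivity))) k.succ_ne_zero
    _ ≤ 2 ^ (k + 1) * Real.exp (-((Real.log u - 1) * growth k n)) := by gcongr

theorem tendsto_mul_unif_real_lt_scaledLongest (hk : 1 ≤ k) {u : ℝ} (hu : Real.exp 1 < u) :
    Tendsto (fun n : ℕ => n * (unif n k).real {A | u < A.scaledLongest}) atTop (𝓝 0) := by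
  have hlog : 0 < Real.log u - 1 :=
    sub_pos.2 ((Real.lt_log_iff_exp_lt ((Real.exp_pos 1).trans hu)).2 hu)
  have hlim := ((tendsto_rpow_mul_exp_neg_mul_atTop_nhds_zero (((k : ℝ) + 1) / k) _ hlog).comp
    (tendsto_growth hk)).const_mul ((2 : ℝ) ^ (k + 1))
  rw [mul_zero] at hlim
  refine squeeze_zero' (Eventually.of_forall fun n => by positivity) ?_ hlim
  filter_upwards [eventually_gt_atTop 0] with n hn
  have hgrowth : growth k n ^ (((k : ℝ) + 1) / k) = n := by
    rw [growth, ← Real.rpow_mul n.cast_nonneg, div_mul_div_cancel₀ (by positivity),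
      div_self (by positivity), Real.rpow_one]
  rw [Function.comp_apply, hgrowth, mul_left_comm, neg_mul]
  gcongr
  exact unif_real_lt_scaledLongest_le hn hu.le

theorem tendsto_unif_real_lt_scaledLongest (hk : 1 ≤ k) {u : ℝ} (hu : Real.exp 1 < u) :
    Tendsto (fun n : ℕ => (unif n k).real {A | u < A.scaledLongest}) atTop (𝓝 0) := by
  refine squeeze_zero' (Eventually.of_forall fun n => measureReal_nonneg) ?_
    (tendsto_mul_unif_real_lt_scaledLongest hk hu)
  filter_upwards [eventually_ge_atTop 1] with n hn
  exact le_mul_of_one_le_left measureReal_nonneg (by exact_mod_cast hn)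

theorem tendsto_pow_div_pow_add_pow_mul {N : ℕ → ℕ} {b : ℝ} (hb : 0 ≤ b)
    (hN : Tendsto (fun n => N n / growth k n) atTop (𝓝 b)) :
    Tendsto (fun n : ℕ => (n : ℝ) ^ k /
      ((N n : ℝ) ^ (k + 1) + (n : ℝ) ^ k * (1 + (N n : ℝ) / n) ^ (k + 1))) atTop
      (𝓝 (1 / (b ^ (k + 1) + 1))) := by
  have hNn : Tendsto (fun n : ℕ => (N n : ℝ) / n) atTop (𝓝 0) := by
    have hmul := hN.mul (tendsto_growth_div k)
    rw [mul_zero] at hmul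
    refine hmul.congr' ?_
    filter_upwards [eventually_gt_atTop 0] with n hn
    rw [div_mul_div_cancel₀ (growth_pos hn).ne']
  have hlim : Tendsto (fun n : ℕ => 1 / ((N n / growth k n) ^ (k + 1) +
      (1 + (N n : ℝ) / n) ^ (k + 1))) atTop (𝓝 (1 / (b ^ (k + 1) + (1 + 0) ^ (k + 1)))) :=
    tendsto_const_nhds.div ((hN.pow _).add ((tendsto_const_nhds.add hNn).pow _)) (by positivity)
  rw [add_zero, one_pow] at hlim
  refine hlim.congr' ?_
  filter_upwards [eventually_gt_atTop 0] with n hn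
  rw [div_pow, growth_pow_add_one]
  field_simp

theorem tendsto_unif_real_scaledLongest_lt (hk : 1 ≤ k) {b : ℝ} (hb : 0 < b) {κ : ℝ}
    (hκ : κ < b / (b ^ (k + 1) + 1)) :
    Tendsto (fun n : ℕ => (unif n k).real {A | A.scaledLongest < κ}) atTop (𝓝 0) := by
  set N : ℕ → ℕ := fun n => ⌊b * growth k n⌋₊
  have hNgrowth : Tendsto (fun n => N n / growth k n) atTop (𝓝 b) :=
    (tendsto_nat_floor_mul_div_atTop hb.le).comp (tendsto_growth hk)
  have hNtop : Tendsto N atTop atTop :=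
    tendsto_nat_floor_atTop.comp ((tendsto_growth hk).const_mul_atTop hb)
  obtain ⟨δ, hδ, hδκ⟩ : ∃ δ > 0, κ < b * (1 / (b ^ (k + 1) + 1) - δ) := by
    obtain ⟨c, hκc, hc⟩ := exists_between hκ
    refine ⟨1 / (b ^ (k + 1) + 1) - c / b, ?_, ?_⟩
    · rw [gt_iff_lt, sub_pos, div_lt_iff₀ hb, one_div_mul_eq_div]
      exact hc
    · rwa [sub_sub_cancel, mul_div_cancel₀ _ hb.ne']
  have hlt := (hNgrowth.mul
    ((tendsto_pow_div_pow_add_pow_mul hb.le hNgrowth).sub_const δ)).eventually_const_lt hδκ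
  have hlim : Tendsto (fun n => 1 / (4 * N n * δ ^ 2)) atTop (𝓝 0) :=
    tendsto_const_nhds.div_atTop (((tendsto_natCast_atTop_atTop.comp hNtop).const_mul_atTop
      four_pos).atTop_mul_const (by positivity))
  refine squeeze_zero' (Eventually.of_forall fun n => measureReal_nonneg) ?_ hlim
  filter_upwards [eventually_gt_atTop 0, hNtop.eventually_gt_atTop 0, hlt] with n hn hNpos hlt
  refine (measureReal_mono fun (A : HDPerm n k) (hA : A.scaledLongest < κ) => ?_).trans
    (unif_real_longestMonotone_lt_le hn hNpos hδ)
  rw [scaledLongest_eq_div] at hA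
  have hdiv := hA.trans hlt
  rwa [div_mul_eq_mul_div, div_lt_div_iff_of_pos_right (growth_pos hn)] at hdiv

/-- The maximum of `b / (b ^ (k + 1) + 1)` is attained at `b ^ (k + 1) = 1 / k`. -/
theorem exists_one_sub_log_add_one_div_le (hk : 1 ≤ k) :
    ∃ b : ℝ, 0 < b ∧ 1 - (Real.log k + 1) / (k + 1) ≤ b / (b ^ (k + 1) + 1) := by
  have hk0 : (0 : ℝ) < k := by exact_mod_cast hk
  set b : ℝ := Real.exp (-(Real.log k / (k + 1)))
  have hpow : b ^ (k + 1) = 1 / k := by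
    rw [← Real.exp_nat_mul, Nat.cast_add_one, mul_neg, mul_div_cancel₀ _ (by positivity),
      Real.exp_neg, Real.exp_log hk0, one_div]
  refine ⟨b, Real.exp_pos _, ?_⟩
  calc 1 - (Real.log k + 1) / ((k : ℝ) + 1)
      ≤ 1 - (Real.log k + 1) / ((k : ℝ) + 1) + Real.log k / ((k : ℝ) + 1) ^ 2 :=
        le_add_of_nonneg_right (by positivity)
    _ = (-(Real.log k / (k + 1)) + 1) / (1 / k + 1) := by field_simp; ring
    _ ≤ b / (b ^ (k + 1) + 1) := by
        rw [hpow]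
        gcongr
        exact Real.add_one_le_exp _

theorem eventually_lt_integral_scaledLongest (hk : 1 ≤ k) {t : ℝ}
    (ht : t < 1 - (Real.log k + 1) / (k + 1)) :
    ∀ᶠ n : ℕ in atTop, t < ∫ A : HDPerm n k, A.scaledLongest ∂unif n k := by
  obtain ⟨b, hb, hle⟩ := exists_one_sub_log_add_one_div_le hk
  obtain ⟨κ, hκ, hκb⟩ := exists_between (max_lt (ht.trans_le hle)
    (by positivity : 0 < b / (b ^ (k + 1) + 1)))
  obtain ⟨htκ, hκ0⟩ := max_lt_iff.1 hκ
  have hlim := ((tendsto_unif_real_scaledLongest_lt hk hb hκb).const_sub 1).const_mul κ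
  rw [sub_zero, mul_one] at hlim
  filter_upwards [hlim.eventually_const_lt htκ] with n hn
  exact hn.trans_le (mul_one_sub_measureReal_lt_le_integral Integrable.of_finite
    scaledLongest_nonneg hκ0.le)

theorem eventually_integral_scaledLongest_lt (hk : 1 ≤ k) {t : ℝ} (ht : Real.exp 1 < t) :
    ∀ᶠ n : ℕ in atTop, ∫ A : HDPerm n k, A.scaledLongest ∂unif n k < t := by
  obtain ⟨u, hu, hut⟩ := exists_between ht
  have hlim := (tendsto_mul_unif_real_lt_scaledLongest hk hu).const_add u
  rw [add_zero] at hlim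
  filter_upwards [hlim.eventually_lt_const hut] with n hn
  exact (integral_le_add_mul_measureReal_lt measurable_from_top Integrable.of_finite
    ((Real.exp_nonneg 1).trans hu.le) scaledLongest_le).trans_lt hn

theorem tendsto_unif_real_scaledLongest_mem_Icc (hk : 1 ≤ k) {ε : ℝ} (hε : 0 < ε) :
    Tendsto (fun n : ℕ => (unif n k).real {A : HDPerm n k |
      A.scaledLongest ∈ Set.Icc (1 / ((k : ℝ) + 2)) (Real.exp 1 + ε)}) atTop (𝓝 1) := by
  have hhalf : 1 / ((k : ℝ) + 2) < 1 / (1 ^ (k + 1) + 1) := by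
    have hk1 : (1 : ℝ) ≤ k := by exact_mod_cast hk
    rw [one_pow]
    exact one_div_lt_one_div_of_lt (by norm_num) (by linarith)
  exact tendsto_measureReal_mem_Icc (tendsto_unif_real_scaledLongest_lt hk one_pos hhalf)
    (tendsto_unif_real_lt_scaledLongest hk (lt_add_of_pos_right _ hε))

end HDPerm

theorem mainTheorem3 (k : ℕ) (hk : 1 ≤ k) :
    (∀ ε : ℝ, 0 < ε →
      Tendsto
        (fun n : ℕ => (HDPerm.unif n k).real
          {A : HDPerm n k |
            A.scaledLongest ∈ Set.Icc (1 / ((k : ℝ) + 2)) (Real.exp 1 + ε)})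
        atTop (𝓝 1)) ∧
    ∃ δ₁ δ₂ : ℕ → ℝ, Tendsto δ₁ atTop (𝓝 0) ∧ Tendsto δ₂ atTop (𝓝 0) ∧
      ∀ n : ℕ, 1 ≤ n →
        1 - (Real.log k + 1) / ((k : ℝ) + 1) - δ₁ n
            ≤ ∫ A : HDPerm n k, A.scaledLongest ∂(HDPerm.unif n k) ∧
        ∫ A : HDPerm n k, A.scaledLongest ∂(HDPerm.unif n k) ≤ Real.exp 1 + δ₂ n := by
  refine ⟨fun ε hε => HDPerm.tendsto_unif_real_scaledLongest_mem_Icc hk hε, ?_⟩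
  obtain ⟨δ₁, hδ₁, hlower⟩ := exists_tendsto_zero_forall_le_add
    (E := fun n : ℕ => -∫ A : HDPerm n k, A.scaledLongest ∂HDPerm.unif n k)
    (a := -(1 - (Real.log k + 1) / ((k : ℝ) + 1))) fun t ht => by
      filter_upwards [HDPerm.eventually_lt_integral_scaledLongest hk (neg_lt.1 ht)] with n hn
      exact neg_lt.1 hn
  obtain ⟨δ₂, hδ₂, hupper⟩ := exists_tendsto_zero_forall_le_add fun t ht =>
    HDPerm.eventually_integral_scaledLongest_lt hk ht
  exact ⟨δ₁, δ₂, hδ₁, hδ₂, fun n _ => ⟨by linarith [hlower n], hupper n⟩⟩
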